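/- **Setting.** Let $P\subset\mathbb R^2$ be a simple rectilinear polygon (closed region bounded by a simple closed curve of $n$ axis-parallel edges, consecutive edges being perpendicular). Its *aspect ratio* $A$ is the ratio of its maximum to its minimum edge length; $P$ is *orthoconvex* if every horizontal and every vertical line meets it in an interval (possibly empty or a point). Points $p,q\in P$ *see* each other if the segment $pq$ lies in $P$. A robot starts at a point $s\in P$ and makes a closed tour inside $P$, along which it takes finitely many scans; a scan taken at $p$ reveals the set of points of $P$ seen from $p$ and which of them lie on the boundary, and nothing is seen between scans. The tour *explores* $P$ if every point of $P$ is seen from some scan point; one may demand in addition that each edge is seen entirely from a single scan point. With a fixed scan cost $c>0$, a tour costs $c\cdot(\text{number of scans})+(L_1\text{-length})$, and $\mathrm{opt}(P,s)$ is the infimum of the costs of all tours from $s$ that explore $P$. A *deterministic online strategy* determines the next move (a curve along which to travel, followed by a scan or by stopping) from $s$ and the outcomes of the scans taken so far. It is *$\rho$-competitive* on a class of polygons if, for every $P$ in the class and every $s\in P$, it stops after finitely many scans, its tour is a closed tour from $s$ inside $P$ that explores $P$, and the cost is at most $\rho\cdot\mathrm{opt}(P,s)$. **Theorem.** There is a constant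 $\kappa>0$ such that, for every scan cost $c>0$ and both with and without the additional demand on the edges, the following hold. 1. For every real $A\ge 1$: if a deterministic online strategy is $\rho$-competitive on the class of orthoconvex polygons of aspect ratio $A$, then $\rho\ge\kappa\log A$. Thus no deterministic strategy has a competitive ratio better than $\Omega(\log A)$, even if the polygon is known in advance to be orthoconvex and $A$ is known. 2. For every even $n\ge 4$: if a deterministic online strategy is $\rho$-competitive on the class of orthoconvex polygons with $n$ edges (and arbitrary coordinates), then $\rho\ge\kappa n$. Thus, in terms of the number of edges alone, there is an $\Omega(n)$ lower bound. -/

import Mathlib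

open scoped NNReal ENNReal

namespace Watchman

/-- Points of the plane, as pairs `(x, y)`. -/
abbrev Plane : Type := ℝ × ℝ

/-! ### Simple rectilinear polygons -/

/-- The cyclic successor on `Fin n`. -/
def next {n : ℕ} (i : Fin n) : Fin n :=
  ⟨(i.val + 1) % n, Nat.mod_lt _ i.pos⟩

/-- `pq` is a nondegenerate horizontal segment. -/
def IsHorizontal (p q : Plane) : Prop := p.2 = q.2 ∧ p.1 ≠ q.1

/-- `pq` is a nondegenerate vertical segment. -/
def IsVertical (p q : Plane) : Prop := p.1 = q.1 ∧ p.2 ≠ q.2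

/-- A simple rectilinear polygon: a simple closed curve with `n` axis-parallel edges, consecutive
edges being perpendicular, together with the closed region that the curve encloses. The region is
the compact, regularly closed set whose frontier is the curve; by the Jordan curve theorem it is
the curve together with its inside, and there is no other such set. -/
structure RectilinearPolygon where
  n : ℕ
  four_le : 4 ≤ n
  vertex : Fin n → Plane
  alternating : ∀ i,
    (IsHorizontal (vertex i) (vertex (next i)) ∧
      IsVertical (vertex (next i)) (vertex (next (next i)))) ∨
    (IsVertical (vertex i) (vertex (next i)) ∧
      IsHorizontal (vertex (next i)) (vertex (next (next i))))
  simple : ∀ i j, i ≠ j → j ≠ next i → i ≠ next j →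
    Disjoint (segment ℝ (vertex i) (vertex (next i))) (segment ℝ (vertex j) (vertex (next j)))
  region : Set Plane
  isCompact_region : IsCompact region
  closure_interior_region : closure (interior region) = region
  frontier_region : frontier region = ⋃ i, segment ℝ (vertex i) (vertex (next i))

namespace RectilinearPolygon

variable (P : RectilinearPolygon)

/-- The `i`-th edge. -/
def edge (i : Fin P.n) : Set Plane := segment ℝ (P.vertex i) (P.vertex (next i))

/-- The length of the `i`-th edge. -/
def edgeLength (i : Fin P.n) : ℝ :=
  |(P.vertex i).1 - (P.vertex (next i)).1| + |(P.vertex i).2 - (P.vertex (next i)).2|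

/-- The ratio of the maximum and the minimum edge length. -/
noncomputable def aspectRatio : ℝ := (⨆ i, P.edgeLength i) / (⨅ i, P.edgeLength i)

/-- Every horizontal and every vertical line meets the polygon in an interval
(possibly empty or a point). -/
def Orthoconvex : Prop :=
  (∀ y : ℝ, {x : ℝ | (x, y) ∈ P.region}.OrdConnected) ∧
  (∀ x : ℝ, {y : ℝ | (x, y) ∈ P.region}.OrdConnected)

/-- The part of the polygon that is visible from `p`. -/
def visible (p : Plane) : Set Plane := {q | segment ℝ p q ⊆ P.region}

end RectilinearPolygon

/-! ### Tours with scans -/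

/-- A parametrized continuous curve in the plane. -/
abbrev Curve : Type := C(unitInterval, Plane)

/-- The length of a curve in the `L₁` metric. -/
noncomputable def Curve.length (γ : Curve) : ℝ≥0∞ :=
  eVariationOn (fun t => WithLp.toLp 1 (γ t)) Set.univ

/-- The curves of the list, traversed one after the other, lead from `p` to `q`. -/
def Joins : Plane → List Curve → Plane → Prop
  | p, [], q => p = q
  | p, γ :: l, q => γ 0 = p ∧ Joins (γ 1) l q

/-- A tour with discrete vision: a scan is taken exactly at the end of each of the `legs`;
afterwards the robot moves along `home` without scanning. -/
structure Tour where
  legs : List Curve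
  home : Curve

/-- The scan points, in order. -/
def Tour.scanPoints (T : Tour) : List Plane := T.legs.map (fun γ => γ 1)

/-- The cost `c * (number of scans) + (tour length)`. -/
noncomputable def Tour.cost (c : ℝ≥0) (T : Tour) : ℝ≥0∞ :=
  c * T.legs.length + ((T.legs.map Curve.length).sum + Curve.length T.home)

/-- What has to be seen: every point of the polygon (`points`), possibly with the additional demand
that each edge is fully visible from a single scan point (`pointsAndEdges`). -/
inductive Rule
  | points
  | pointsAndEdges

/-- `T` is a closed tour from `s`, it stays in `P`, and its scans explore `P`. -/
structure Tour.Explores (T : Tour) (r : Rule) (P : RectilinearPolygon) (s : Plane) : Prop where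
  joins : Joins s (T.legs ++ [T.home]) s
  stays : ∀ γ ∈ T.legs ++ [T.home], ∀ t, γ t ∈ P.region
  sees : ∀ q ∈ P.region, ∃ p ∈ T.scanPoints, q ∈ P.visible p
  sees_edges : r = Rule.pointsAndEdges → ∀ i, ∃ p ∈ T.scanPoints, P.edge i ⊆ P.visible p

/-- The offline optimum: the least cost of a tour that explores `P` from `s`. -/
noncomputable def opt (r : Rule) (c : ℝ≥0) (P : RectilinearPolygon) (s : Plane) : ℝ≥0∞ :=
  ⨅ (T : Tour) (_ : T.Explores r P s), T.cost c

/-! ### Online strategies -/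

/-- The outcome of a scan: its position, the visible part of the polygon, and the visible part of
the boundary. -/
structure Observation where
  position : Plane
  visible : Set Plane
  visibleBoundary : Set Plane

/-- The scan of `P` taken from `p`. -/
def scan (P : RectilinearPolygon) (p : Plane) : Observation where
  position := p
  visible := P.visible p
  visibleBoundary := P.visible p ∩ frontier P.region

/-- The next action of the robot: move along a curve and scan at its end,
or move along a curve and stop. -/
inductive Action
  | moveAndScan (γ : Curve)
  | finish (γ : Curve)

/-- A deterministic online strategy: the next action is a function of the starting point and of the
outcomes of all scans taken so far. -/
abbrev Strategy : Type := Plane → List Observation → Action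

/-- `T` is the tour that the strategy `σ` makes in `P` from `s`. -/
def Strategy.Produces (σ : Strategy) (P : RectilinearPolygon) (s : Plane) (T : Tour) : Prop :=
  (∀ (i : ℕ) (hi : i < T.legs.length),
    σ s ((T.scanPoints.take i).map (scan P)) = Action.moveAndScan T.legs[i]) ∧
  σ s (T.scanPoints.map (scan P)) = Action.finish T.home

/-- `σ` has competitive ratio (at most) `ρ` on a class of polygons: for every polygon of the class
and every starting point in it, `σ` stops after finitely many scans, has explored the polygon, and
its cost is at most `ρ` times the offline optimum. -/
def Strategy.IsCompetitive (σ : Strategy) (r : Rule) (c : ℝ≥0) (Cl : Set RectilinearPolygon)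
    (ρ : ℝ≥0) : Prop :=
  ∀ P ∈ Cl, ∀ s ∈ P.region, ∃ T : Tour,
    σ.Produces P s T ∧ T.Explores r P s ∧ T.cost c ≤ ρ * opt r c P s

end Watchman

namespace Watchman

/-! ### Axis-parallel segments -/

/-! The hard instances are pyramids: rectangles standing on a common base, each three times as high
as the previous one, over nested intervals. Every second rectangle stands over a full interval of a
sequence in which each interval is a ninth as wide as its predecessor and sits near its left or
right end, according to a hidden bit. All rectangles share a base point, and by convexity it sees
everything. With base width `c / 2`, a tour with one scan there costs at most `2 * c`.

Online, the bits are fixed by an adversary. A scan point at horizontal distance more than the width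
of an interval from that interval cannot see the top of the rectangle over it: the midpoint of the
sight line would still be too high to lie in any lower rectangle, hence would lie over the interval,
which would put the scan point within one width of it (`snd_lt_of_visible`). Since the strategy is
deterministic, its next scan point is known before the next bit is chosen, and the next interval can
be put far from it (`exists_bit_far`). Pyramids with the same first bits look the same from all
scans made so far (`scan_eq_of_agree`), so each scan uncovers at most one interval, that is, two of
the `K` rectangles (`exists_bits_of_strategy`). Hence at least `K / 2` scans are needed and `K ≤ 4 *
ρ` (`competitive_ratio_ge`).

A pyramid has `2 * K + 2` edges, which gives the linear bound. For odd `K`, any aspect ratio from `9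
^ ((K - 1) / 2)` on can be realized, which gives the logarithmic bound. -/

theorem mem_segment_vertical {x y z : ℝ} {q : Plane} :
    q ∈ segment ℝ ((x, y) : Plane) (x, z) ↔ q.1 = x ∧ q.2 ∈ Set.uIcc y z := by
  rw [← Prod.image_mk_segment_right, segment_eq_uIcc]
  constructor
  · rintro ⟨t, ht, rfl⟩
    exact ⟨rfl, ht⟩
  · rintro ⟨h, hq⟩
    exact ⟨q.2, hq, Prod.ext h.symm rfl⟩

theorem mem_segment_horizontal {x y z : ℝ} {q : Plane} :
    q ∈ segment ℝ ((x, z) : Plane) (y, z) ↔ q.1 ∈ Set.uIcc x y ∧ q.2 = z := by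
  rw [← Prod.image_mk_segment_left, segment_eq_uIcc]
  constructor
  · rintro ⟨t, ht, rfl⟩
    exact ⟨ht, rfl⟩
  · rintro ⟨hq, h⟩
    exact ⟨q.1, hq, Prod.ext rfl h.symm⟩

/-! ### Histograms -/

/-- A histogram with `K` bars: the `j`-th bar is `[X j, X (j + 1)] × [0, Y (j + 1)]`. -/
structure Histogram where
  K : ℕ
  K_pos : 0 < K
  X : ℕ → ℝ
  Y : ℕ → ℝ
  X_lt : ∀ i j, i < j → j ≤ K → X i < X j
  Y_zero : Y 0 = 0
  Y_last : Y (K + 1) = 0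
  Y_pos : ∀ j < K, 0 < Y (j + 1)
  Y_ne : ∀ j ≤ K, Y j ≠ Y (j + 1)

namespace Histogram

variable (S : Histogram)

def region : Set Plane :=
  {q | ∃ j < S.K, (S.X j ≤ q.1 ∧ q.1 ≤ S.X (j + 1)) ∧ 0 ≤ q.2 ∧ q.2 ≤ S.Y (j + 1)}

/-- The curve alternately steps vertically (even `i`) and horizontally (odd `i`). The zero heights
`Y 0` and `Y (K + 1)` make the two outer walls ordinary height jumps, and the last edge is the base.
-/
def vertex (i : Fin (2 * S.K + 2)) : Plane := (S.X (i / 2), S.Y ((i + 1) / 2))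

theorem X_le {i j : ℕ} (h : i ≤ j) (hj : j ≤ S.K) : S.X i ≤ S.X j := by
  rcases h.eq_or_lt with rfl | h
  · exact le_rfl
  · exact (S.X_lt _ _ h hj).le

theorem Y_nonneg {j : ℕ} (hj : j ≤ S.K + 1) : 0 ≤ S.Y j := by
  rcases j with _ | j
  · exact S.Y_zero.ge
  · rcases (Nat.lt_or_ge j S.K) with h | h
    · exact (S.Y_pos j h).le
    · obtain rfl : j = S.K := by omega
      exact S.Y_last.ge

/-- Every edge is a vertical one, the top of a bar, or the base. -/
theorem edge_cases (i : Fin (2 * S.K + 2)) :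
    (∃ j ≤ S.K, i.val = 2 * j ∧ S.vertex i = (S.X j, S.Y j) ∧
      S.vertex (next i) = (S.X j, S.Y (j + 1)) ∧ (next i).val = 2 * j + 1) ∨
    (∃ j < S.K, i.val = 2 * j + 1 ∧ S.vertex i = (S.X j, S.Y (j + 1)) ∧
      S.vertex (next i) = (S.X (j + 1), S.Y (j + 1)) ∧ (next i).val = 2 * j + 2) ∨
    (i.val = 2 * S.K + 1 ∧ S.vertex i = (S.X S.K, 0) ∧ S.vertex (next i) = (S.X 0, 0) ∧
      (next i).val = 0) := by
  have hi := i.isLt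
  rcases Nat.even_or_odd' i.val with ⟨j, hj | hj⟩
  · have hn : (next i).val = 2 * j + 1 := by
      simp only [next, hj]; exact Nat.mod_eq_of_lt (by omega)
    refine Or.inl ⟨j, by omega, hj, ?_, ?_, hn⟩
    · simp only [vertex, hj]
      rw [show 2 * j / 2 = j by omega, show (2 * j + 1) / 2 = j by omega]
    · simp only [vertex, hn]
      rw [show (2 * j + 1) / 2 = j by omega, show (2 * j + 1 + 1) / 2 = j + 1 by omega]
  · rcases Nat.lt_or_ge j S.K with hjK | hjK
    · have hn : (next i).val = 2 * j + 2 := by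
        simp only [next, hj]; exact Nat.mod_eq_of_lt (by omega)
      refine Or.inr (Or.inl ⟨j, hjK, hj, ?_, ?_, hn⟩)
      · simp only [vertex, hj]
        rw [show (2 * j + 1) / 2 = j by omega, show (2 * j + 1 + 1) / 2 = j + 1 by omega]
      · simp only [vertex, hn]
        rw [show (2 * j + 2) / 2 = j + 1 by omega, show (2 * j + 2 + 1) / 2 = j + 1 by omega]
    · obtain rfl : j = S.K := by omega
      have hn : (next i).val = 0 := by
        simp only [next, hj]; exact Nat.mod_self _
      refine Or.inr (Or.inr ⟨hj, ?_, ?_, hn⟩)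
      · simp only [vertex, hj]
        rw [show (2 * S.K + 1) / 2 = S.K by omega,
          show (2 * S.K + 1 + 1) / 2 = S.K + 1 by omega, S.Y_last]
      · simp only [vertex, hn]
        rw [Nat.zero_div, S.Y_zero]

theorem alternating (i : Fin (2 * S.K + 2)) :
    (IsHorizontal (S.vertex i) (S.vertex (next i)) ∧
      IsVertical (S.vertex (next i)) (S.vertex (next (next i)))) ∨
    (IsVertical (S.vertex i) (S.vertex (next i)) ∧
      IsHorizontal (S.vertex (next i)) (S.vertex (next (next i)))) := by
  have hK := S.K_pos
  rcases S.edge_cases i with ⟨j, hj, -, h1, h2, h3⟩ | ⟨j, hj, -, h1, h2, h3⟩ | ⟨-, h1, h2, h3⟩ <;>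
  rcases S.edge_cases (next i) with
    ⟨l, hl, k0, k1, k2, k3⟩ | ⟨l, hl, k0, k1, k2, k3⟩ | ⟨k0, k1, k2, k3⟩ <;>
  first
  | (exfalso; omega)
  | skip
  · obtain rfl : l = j := by omega
    right
    rw [h1, h2, k2]
    exact ⟨⟨rfl, S.Y_ne _ hj⟩, rfl, (S.X_lt _ _ (Nat.lt_succ_self _) hl).ne⟩
  · right
    rw [k1, h1, k2]
    obtain rfl : j = S.K := by omega
    refine ⟨⟨rfl, ?_⟩, rfl, (S.X_lt 0 S.K hK le_rfl).ne'⟩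
    have := S.Y_ne S.K le_rfl
    rwa [S.Y_last] at this
  · obtain rfl : l = j + 1 := by omega
    left
    rw [h1, h2, k2]
    exact ⟨⟨rfl, (S.X_lt _ _ (Nat.lt_succ_self _) hl).ne⟩, rfl, S.Y_ne _ hl⟩
  · obtain rfl : l = 0 := by omega
    left
    rw [h1, h2, k2]
    refine ⟨⟨rfl, (S.X_lt 0 S.K hK le_rfl).ne'⟩, rfl, ?_⟩
    have := S.Y_ne 0 (Nat.zero_le _)
    rwa [S.Y_zero] at this

theorem mem_top {j : ℕ} (hj : j < S.K) {y : ℝ} {q : Plane} :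
    q ∈ segment ℝ ((S.X j, y) : Plane) (S.X (j + 1), y) ↔
      (S.X j ≤ q.1 ∧ q.1 ≤ S.X (j + 1)) ∧ q.2 = y := by
  rw [mem_segment_horizontal, Set.uIcc_of_le (S.X_le (Nat.le_succ j) hj), Set.mem_Icc]

theorem mem_base {q : Plane} :
    q ∈ segment ℝ ((S.X S.K, 0) : Plane) (S.X 0, 0) ↔
      (S.X 0 ≤ q.1 ∧ q.1 ≤ S.X S.K) ∧ q.2 = 0 := by
  rw [mem_segment_horizontal, Set.uIcc_of_ge (S.X_le (Nat.zero_le _) le_rfl), Set.mem_Icc]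

/-- Most pairs of edges are separated by abscissas. The exceptions are neighbouring tops, which have
different heights, and the base against an inner wall or a top, where positive bar heights separate
them. -/
theorem simple_aux {i j : Fin (2 * S.K + 2)} (hlt : i.val < j.val) (h1 : j ≠ next i)
    (h2 : i ≠ next j) :
    Disjoint (segment ℝ (S.vertex i) (S.vertex (next i)))
      (segment ℝ (S.vertex j) (S.vertex (next j))) := by
  rw [Ne, Fin.ext_iff] at h1 h2
  rw [Set.disjoint_left]
  intro q hq hq'
  rcases S.edge_cases i with
    ⟨k, hk, a0, a1, a2, a3⟩ | ⟨k, hk, a0, a1, a2, a3⟩ | ⟨a0, a1, a2, a3⟩ <;>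
  rcases S.edge_cases j with
    ⟨l, hl, b0, b1, b2, b3⟩ | ⟨l, hl, b0, b1, b2, b3⟩ | ⟨b0, b1, b2, b3⟩ <;>
  rw [a1, a2] at hq <;> rw [b1, b2] at hq' <;>
  first
  | (exfalso; omega)
  | skip
  · rw [mem_segment_vertical] at hq hq'
    have := S.X_lt k l (by omega) hl
    linarith [hq.1, hq'.1]
  · rw [mem_segment_vertical] at hq
    rw [S.mem_top hl] at hq'
    have := S.X_lt k l (by omega) hl.le
    linarith [hq.1, hq'.1.1]
  · rw [mem_segment_vertical] at hq
    rw [S.mem_base] at hq'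
    rcases k with _ | k
    · omega
    · have hkK : k + 1 < S.K := by omega
      have e1 := S.Y_pos k (by omega)
      have e2 := S.Y_pos (k + 1) hkK
      have := hq.2
      rw [hq'.2, Set.mem_uIcc] at this
      rcases this with h | h <;> linarith [h.1, h.2]
  · rw [mem_segment_vertical] at hq'
    rw [S.mem_top hk] at hq
    have := S.X_lt (k + 1) l (by omega) hl
    linarith [hq'.1, hq.1.2]
  · rw [S.mem_top hl] at hq'
    rw [S.mem_top hk] at hq
    rcases (show l = k + 1 ∨ k + 1 < l by omega) with rfl | h
    · exact S.Y_ne (k + 1) hk (hq.2.symm.trans hq'.2)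
    · have := S.X_lt (k + 1) l h hl.le
      linarith [hq.1.2, hq'.1.1]
  · rw [S.mem_base] at hq'
    rw [S.mem_top hk] at hq
    have := S.Y_pos k hk
    linarith [hq.2, hq'.2]

theorem simple (i j : Fin (2 * S.K + 2)) (hij : i ≠ j) (h1 : j ≠ next i) (h2 : i ≠ next j) :
    Disjoint (segment ℝ (S.vertex i) (S.vertex (next i)))
      (segment ℝ (S.vertex j) (S.vertex (next j))) := by
  rcases lt_or_gt_of_ne (fun h => hij (Fin.ext h)) with h | h
  · exact S.simple_aux h h1 h2
  · exact (S.simple_aux h h2 h1).symm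

theorem mem_iUnion_edges {q : Plane} :
    (q ∈ ⋃ i, segment ℝ (S.vertex i) (S.vertex (next i))) ↔
      (∃ j ≤ S.K, q.1 = S.X j ∧ q.2 ∈ Set.uIcc (S.Y j) (S.Y (j + 1))) ∨
      (∃ j < S.K, (S.X j ≤ q.1 ∧ q.1 ≤ S.X (j + 1)) ∧ q.2 = S.Y (j + 1)) ∨
      ((S.X 0 ≤ q.1 ∧ q.1 ≤ S.X S.K) ∧ q.2 = 0) := by
  rw [Set.mem_iUnion]
  constructor
  · rintro ⟨i, hi⟩
    rcases S.edge_cases i with ⟨k, hk, a0, a1, a2, a3⟩ | ⟨k, hk, a0, a1, a2, a3⟩ | ⟨a0, a1, a2, a3⟩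
    · rw [a1, a2, mem_segment_vertical] at hi
      exact Or.inl ⟨k, hk, hi⟩
    · rw [a1, a2, S.mem_top hk] at hi
      exact Or.inr (Or.inl ⟨k, hk, hi⟩)
    · rw [a1, a2, S.mem_base] at hi
      exact Or.inr (Or.inr hi)
  · rintro (⟨j, hj, h⟩ | ⟨j, hj, h⟩ | h)
    · refine ⟨⟨2 * j, by omega⟩, ?_⟩
      rcases S.edge_cases ⟨2 * j, by omega⟩ with
        ⟨k, hk, a0, a1, a2, a3⟩ | ⟨k, hk, a0, a1, a2, a3⟩ | ⟨a0, a1, a2, a3⟩ <;>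
        dsimp only at a0
      · obtain rfl : k = j := by omega
        rwa [a1, a2, mem_segment_vertical]
      · omega
      · omega
    · refine ⟨⟨2 * j + 1, by omega⟩, ?_⟩
      rcases S.edge_cases ⟨2 * j + 1, by omega⟩ with
        ⟨k, hk, a0, a1, a2, a3⟩ | ⟨k, hk, a0, a1, a2, a3⟩ | ⟨a0, a1, a2, a3⟩ <;>
        dsimp only at a0
      · omega
      · obtain rfl : k = j := by omega
        rwa [a1, a2, S.mem_top hk]
      · omega
    · refine ⟨⟨2 * S.K + 1, by omega⟩, ?_⟩
      rcases S.edge_cases ⟨2 * S.K + 1, by omega⟩ with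
        ⟨k, hk, a0, a1, a2, a3⟩ | ⟨k, hk, a0, a1, a2, a3⟩ | ⟨a0, a1, a2, a3⟩ <;>
        dsimp only at a0
      · omega
      · omega
      · rwa [a1, a2, S.mem_base]

/-! ### Topology of the histogram region. -/

theorem region_eq_biUnion : S.region =
    ⋃ j ∈ Set.Iio S.K, Set.Icc (S.X j) (S.X (j + 1)) ×ˢ Set.Icc 0 (S.Y (j + 1)) := by
  ext q
  simp only [region, Set.mem_iUnion, Set.mem_Iio, Set.mem_prod, Set.mem_Icc, exists_prop,
    Set.mem_ofPred_eq]

theorem isCompact_region : IsCompact S.region := by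
  rw [region_eq_biUnion]
  exact (Set.finite_Iio S.K).isCompact_biUnion fun j _ => isCompact_Icc.prod isCompact_Icc

theorem closure_interior_region : closure (interior S.region) = S.region := by
  apply Set.Subset.antisymm
  · exact closure_minimal interior_subset S.isCompact_region.isClosed
  · intro q hq
    obtain ⟨j, hj, hx, hy⟩ := hq
    have hX := (S.X_lt j (j + 1) (Nat.lt_succ_self j) hj).ne
    have hY := (S.Y_pos j hj).ne
    have hsub : Set.Ioo (S.X j) (S.X (j + 1)) ×ˢ Set.Ioo 0 (S.Y (j + 1)) ⊆ interior S.region :=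
      interior_maximal
        (fun p hp => ⟨j, hj, ⟨hp.1.1.le, hp.1.2.le⟩, hp.2.1.le, hp.2.2.le⟩)
        (isOpen_Ioo.prod isOpen_Ioo)
    apply closure_mono hsub
    rw [closure_prod_eq, closure_Ioo hX, closure_Ioo hY]
    exact ⟨hx, hy⟩

theorem mem_interior_of_box {a b c : ℝ} {q : Plane} (hx : q.1 ∈ Set.Ioo a b)
    (hy : q.2 ∈ Set.Ioo 0 c)
    (h : ∀ x ∈ Set.Ioo a b, ∀ y ∈ Set.Ioo 0 c, ((x, y) : Plane) ∈ S.region) :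
    q ∈ interior S.region :=
  interior_maximal (fun p hp => h p.1 hp.1 p.2 hp.2) (isOpen_Ioo.prod isOpen_Ioo) ⟨hx, hy⟩

/-- A set contains a box around each of its interior points. -/
theorem exists_of_mem_interior {s : Set Plane} {q : Plane} (hq : q ∈ interior s) :
    ∃ ε > 0, ∀ x y, |x - q.1| < ε → |y - q.2| < ε → ((x, y) : Plane) ∈ s := by
  obtain ⟨ε, hε, h⟩ := Metric.mem_nhds_iff.1 (mem_interior_iff_mem_nhds.1 hq)
  refine ⟨ε, hε, fun x y hx hy => h ?_⟩
  rw [Metric.mem_ball, Prod.dist_eq, max_lt_iff]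
  exact ⟨hx, hy⟩

theorem fst_mem_of_mem_region {q : Plane} (hq : q ∈ S.region) : S.X 0 ≤ q.1 ∧ q.1 ≤ S.X S.K := by
  obtain ⟨j, hj, hx, -⟩ := hq
  exact ⟨(S.X_le (Nat.zero_le j) hj.le).trans hx.1, hx.2.trans (S.X_le hj le_rfl)⟩

theorem snd_le_of_mem_region {q : Plane} (hq : q ∈ S.region) {j : ℕ} (hj : j < S.K)
    (hx : S.X j < q.1 ∧ q.1 < S.X (j + 1)) : q.2 ≤ S.Y (j + 1) := by
  obtain ⟨i, hi, hx', -, hy⟩ := hq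
  rcases lt_trichotomy i j with h | rfl | h
  · linarith [S.X_le (show i + 1 ≤ j from h) hj.le, hx.1, hx'.2]
  · exact hy
  · linarith [S.X_le (show j + 1 ≤ i from h) hi.le, hx.2, hx'.1]

/-- At a grid line the neighbouring bar may be higher, so the witness outside the region is moved
slightly into the open bar as well as upwards. -/
theorem not_mem_interior_of_top {q : Plane} {j : ℕ} (hj : j < S.K)
    (hx : S.X j ≤ q.1 ∧ q.1 ≤ S.X (j + 1)) (hy : S.Y (j + 1) ≤ q.2) :
    q ∉ interior S.region := by
  intro hq
  obtain ⟨ε, hε, h⟩ := exists_of_mem_interior hq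
  have hX := S.X_lt j (j + 1) (Nat.lt_succ_self j) hj
  obtain ⟨x, hx1, hx2⟩ : ∃ x, |x - q.1| < ε ∧ S.X j < x ∧ x < S.X (j + 1) := by
    rcases hx.2.lt_or_eq with h' | h'
    · obtain ⟨x, h1, h2⟩ := exists_between (lt_min h' (show q.1 < q.1 + ε by linarith))
      rw [lt_min_iff] at h2
      exact ⟨x, by rw [abs_lt]; constructor <;> linarith [h2.2], by linarith [hx.1], h2.1⟩
    · obtain ⟨x, h1, h2⟩ := exists_between
        (max_lt (show S.X j < q.1 by linarith) (show q.1 - ε < q.1 by linarith))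
      rw [max_lt_iff] at h1
      exact ⟨x, by rw [abs_lt]; constructor <;> linarith [h1.2], h1.1, by linarith⟩
  have := S.snd_le_of_mem_region
    (h x (q.2 + ε / 2) hx1 (by rw [abs_lt]; constructor <;> linarith)) hj hx2
  dsimp only at this
  linarith

theorem exists_between_X {x : ℝ} {m k : ℕ} (hmk : m < k) (h : S.X m ≤ x) (h' : x ≤ S.X k) :
    ∃ j, m ≤ j ∧ j < k ∧ S.X j ≤ x ∧ x ≤ S.X (j + 1) := by
  induction k, hmk using Nat.le_induction with
  | base => exact ⟨m, le_rfl, Nat.lt_succ_self m, h, h'⟩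
  | succ k hk ih =>
    rcases le_total x (S.X k) with hx | hx
    · obtain ⟨j, h1, h2, h3⟩ := ih hx
      exact ⟨j, h1, by omega, h3⟩
    · exact ⟨k, by omega, by omega, hx, h'⟩

theorem iUnion_edges_subset {q : Plane}
    (hq : q ∈ ⋃ i, segment ℝ (S.vertex i) (S.vertex (next i))) :
    q ∈ S.region \ interior S.region := by
  have hK := S.K_pos
  rw [mem_iUnion_edges] at hq
  rcases hq with ⟨j, hj, hx, hy⟩ | ⟨j, hj, hx, hy⟩ | ⟨hx, hy⟩
  · have h0 : 0 ≤ q.2 := by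
      have h1 := S.Y_nonneg (show j ≤ S.K + 1 by omega)
      have h2 := S.Y_nonneg (show j + 1 ≤ S.K + 1 by omega)
      exact (le_min h1 h2).trans hy.1
    constructor
    · rcases Nat.eq_zero_or_pos j with rfl | hpos
      · refine ⟨0, hK, ⟨hx.ge, hx.le.trans (S.X_le (Nat.zero_le _) hK)⟩, h0, ?_⟩
        have := hy.2
        rwa [S.Y_zero, sup_of_le_right (S.Y_pos 0 hK).le] at this
      · obtain ⟨l, rfl⟩ : ∃ l, j = l + 1 := ⟨j - 1, by omega⟩
        rcases le_max_iff.1 hy.2 with h | h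
        · exact ⟨l, hj, ⟨(S.X_le (Nat.le_succ l) hj).trans hx.ge, hx.le⟩, h0, h⟩
        · rcases hj.lt_or_eq with hj | hj
          · exact ⟨l + 1, hj, ⟨hx.ge, hx.le.trans (S.X_le (Nat.le_succ _) hj)⟩, h0, h⟩
          · refine ⟨l, by omega, ⟨(S.X_le (Nat.le_succ l) hj.le).trans hx.ge, hx.le⟩, h0, ?_⟩
            rw [hj, S.Y_last] at h
            exact h.trans (S.Y_pos l (by omega)).le
    · rcases min_le_iff.1 hy.1 with h | h
      · rcases Nat.eq_zero_or_pos j with rfl | hpos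
        · intro hq
          obtain ⟨ε, hε, h'⟩ := exists_of_mem_interior hq
          have := (S.fst_mem_of_mem_region (h' (q.1 - ε / 2) q.2
            (by rw [abs_lt]; constructor <;> linarith) (by simpa using hε))).1
          dsimp only at this
          linarith
        · obtain ⟨l, rfl⟩ : ∃ l, j = l + 1 := ⟨j - 1, by omega⟩
          exact S.not_mem_interior_of_top hj ⟨(S.X_le (Nat.le_succ l) hj).trans hx.ge, hx.le⟩ h
      · rcases hj.lt_or_eq with hj | rfl
        · exact S.not_mem_interior_of_top hj ⟨hx.ge, hx.le.trans (S.X_le (Nat.le_succ _) hj)⟩ h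
        · intro hq
          obtain ⟨ε, hε, h'⟩ := exists_of_mem_interior hq
          have := (S.fst_mem_of_mem_region (h' (q.1 + ε / 2) q.2
            (by rw [abs_lt]; constructor <;> linarith) (by simpa using hε))).2
          dsimp only at this
          linarith
  · exact ⟨⟨j, hj, hx, hy ▸ (S.Y_pos j hj).le, hy.le⟩, S.not_mem_interior_of_top hj hx hy.ge⟩
  · constructor
    · obtain ⟨j, -, hj, hx'⟩ := S.exists_between_X hK hx.1 hx.2
      exact ⟨j, hj, hx', hy.ge, hy.le.trans (S.Y_pos j hj).le⟩
    · intro hq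
      obtain ⟨ε, hε, h'⟩ := exists_of_mem_interior hq
      obtain ⟨j, -, -, h0, -⟩ := h' q.1 (q.2 - ε / 2) (by simpa using hε)
            (by rw [abs_lt]; constructor <;> linarith)
      dsimp only at h0
      linarith

theorem mem_iUnion_edges_of_frontier {q : Plane} (hq : q ∈ S.region)
    (hq' : q ∉ interior S.region) :
    q ∈ ⋃ i, segment ℝ (S.vertex i) (S.vertex (next i)) := by
  have hK := S.K_pos
  rw [mem_iUnion_edges]
  by_contra hne
  push Not at hne
  obtain ⟨hv, ht, hb⟩ := hne
  have hx0 := S.fst_mem_of_mem_region hq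
  obtain ⟨j, hj, hx, hy0, hy⟩ := hq
  have hypos : 0 < q.2 := lt_of_le_of_ne hy0 (Ne.symm (hb hx0))
  have hylt : q.2 < S.Y (j + 1) := lt_of_le_of_ne hy (ht j hj hx)
  -- on a vertical grid line, the point would lie below both neighbouring bars, hence inside
  have key : ∀ l ≤ S.K, q.1 = S.X l → q.2 ≤ max (S.Y l) (S.Y (l + 1)) → False := by
    intro l hl hxl hmax
    have hmin : q.2 < min (S.Y l) (S.Y (l + 1)) := by
      by_contra hcon
      exact hv l hl hxl ⟨not_lt.1 hcon, hmax⟩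
    rw [lt_min_iff] at hmin
    rcases l with _ | l
    · linarith [S.Y_zero, hmin.1]
    · rcases hl.lt_or_eq with hlK | hlK
      · apply hq'
        refine S.mem_interior_of_box (a := S.X l) (b := S.X (l + 1 + 1))
          (c := min (S.Y (l + 1)) (S.Y (l + 1 + 1))) ⟨?_, ?_⟩ ⟨hypos, ?_⟩ ?_
        · rw [hxl]; exact S.X_lt _ _ (Nat.lt_succ_self _) hl
        · rw [hxl]; exact S.X_lt _ _ (Nat.lt_succ_self _) hlK
        · exact lt_min hmin.1 hmin.2
        · intro x hx y hy
          have hy2 := lt_min_iff.1 hy.2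
          rcases le_total x (S.X (l + 1)) with h | h
          · exact ⟨l, hl, ⟨hx.1.le, h⟩, hy.1.le, hy2.1.le⟩
          · exact ⟨l + 1, hlK, ⟨h, hx.2.le⟩, hy.1.le, hy2.2.le⟩
      · rw [hlK, S.Y_last] at hmin
        linarith [hmin.2]
  rcases hx.1.lt_or_eq with h1 | h1
  · rcases hx.2.lt_or_eq with h2 | h2
    · exact hq' (S.mem_interior_of_box ⟨h1, h2⟩ ⟨hypos, hylt⟩
        fun x hx y hy => ⟨j, hj, ⟨hx.1.le, hx.2.le⟩, hy.1.le, hy.2.le⟩)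
    · exact key (j + 1) hj h2 (le_max_of_le_left hy)
  · exact key j hj.le h1.symm (le_max_of_le_right hy)

theorem frontier_region :
    frontier S.region = ⋃ i, segment ℝ (S.vertex i) (S.vertex (next i)) := by
  rw [S.isCompact_region.isClosed.frontier_eq]
  exact Set.Subset.antisymm (fun q hq => S.mem_iUnion_edges_of_frontier hq.1 hq.2)
    fun q hq => S.iUnion_edges_subset hq

/-- The rectilinear polygon with the shape of the histogram. -/
def toPolygon : RectilinearPolygon where
  n := 2 * S.K + 2
  four_le := by have := S.K_pos; omega
  vertex := S.vertex
  alternating := S.alternating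
  simple := S.simple
  region := S.region
  isCompact_region := S.isCompact_region
  closure_interior_region := S.closure_interior_region
  frontier_region := S.frontier_region

/-- If all bar widths and all jumps of the height lie between `u` and the total width, and the last
bar has height `u`, then the aspect ratio is the total width divided by `u`. -/
theorem aspectRatio_toPolygon {u : ℝ}
    (hX : ∀ j < S.K, u ≤ S.X (j + 1) - S.X j)
    (hY : ∀ j ≤ S.K, u ≤ |S.Y j - S.Y (j + 1)| ∧ |S.Y j - S.Y (j + 1)| ≤ S.X S.K - S.X 0)
    (hu : S.Y S.K = u) :
    S.toPolygon.aspectRatio = (S.X S.K - S.X 0) / u := by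
  have hK := S.K_pos
  have hwidth : u ≤ S.X S.K - S.X 0 := (hY 0 (Nat.zero_le _)).1.trans (hY 0 (Nat.zero_le _)).2
  have hbound : ∀ i : Fin (2 * S.K + 2), u ≤ S.toPolygon.edgeLength i ∧
      S.toPolygon.edgeLength i ≤ S.X S.K - S.X 0 := by
    intro i
    change u ≤ |(S.vertex i).1 - (S.vertex (next i)).1| + |(S.vertex i).2 - (S.vertex (next i)).2| ∧
      |(S.vertex i).1 - (S.vertex (next i)).1| + |(S.vertex i).2 - (S.vertex (next i)).2| ≤ _
    rcases S.edge_cases i with ⟨k, hk, a0, a1, a2, a3⟩ | ⟨k, hk, a0, a1, a2, a3⟩ | ⟨a0, a1, a2, a3⟩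
      <;> rw [a1, a2] <;> dsimp only <;> rw [sub_self, abs_zero]
    · rw [zero_add]; exact hY k hk
    · rw [add_zero, abs_sub_comm, abs_of_pos (sub_pos.2 (S.X_lt _ _ (Nat.lt_succ_self k) hk))]
      refine ⟨hX k hk, ?_⟩
      linarith [S.X_le (Nat.zero_le k) hk.le, S.X_le (show k + 1 ≤ S.K from hk) le_rfl]
    · rw [add_zero, abs_of_pos (sub_pos.2 (S.X_lt _ _ hK le_rfl))]
      exact ⟨hwidth, le_rfl⟩
  -- The base attains the maximum.
  have hlast : S.toPolygon.edgeLength (⟨2 * S.K + 1, by omega⟩ : Fin (2 * S.K + 2)) =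
      S.X S.K - S.X 0 := by
    set i : Fin (2 * S.K + 2) := ⟨2 * S.K + 1, by omega⟩ with hi
    change |(S.vertex i).1 - (S.vertex (next i)).1| +
      |(S.vertex i).2 - (S.vertex (next i)).2| = _
    rcases S.edge_cases i with
      ⟨k, hk, a0, a1, a2, a3⟩ | ⟨k, hk, a0, a1, a2, a3⟩ | ⟨a0, a1, a2, a3⟩
    · rw [hi] at a0; dsimp only at a0; omega
    · rw [hi] at a0; dsimp only at a0; omega
    · rw [a1, a2]; dsimp only
      rw [sub_self, abs_zero, add_zero, abs_of_pos (sub_pos.2 (S.X_lt _ _ hK le_rfl))]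
  -- The right outer wall attains the minimum.
  have hmin : S.toPolygon.edgeLength (⟨2 * S.K, by omega⟩ : Fin (2 * S.K + 2)) = u := by
    set i : Fin (2 * S.K + 2) := ⟨2 * S.K, by omega⟩ with hi
    change |(S.vertex i).1 - (S.vertex (next i)).1| +
      |(S.vertex i).2 - (S.vertex (next i)).2| = _
    rcases S.edge_cases i with
      ⟨k, hk, a0, a1, a2, a3⟩ | ⟨k, hk, a0, a1, a2, a3⟩ | ⟨a0, a1, a2, a3⟩
    · obtain rfl : k = S.K := by rw [hi] at a0; dsimp only at a0; omega
      rw [a1, a2]; dsimp only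
      rw [sub_self, abs_zero, zero_add, S.Y_last, sub_zero, hu, abs_of_nonneg]
      rw [← hu]; exact S.Y_nonneg (Nat.le_succ _)
    · rw [hi] at a0; dsimp only at a0; omega
    · rw [hi] at a0; dsimp only at a0; omega
  have : Nonempty (Fin S.toPolygon.n) := ⟨⟨0, by have := S.toPolygon.four_le; omega⟩⟩
  rw [RectilinearPolygon.aspectRatio]
  congr 1
  · apply le_antisymm (ciSup_le fun i => (hbound i).2)
    rw [← hlast]
    exact le_ciSup (Set.finite_range S.toPolygon.edgeLength).bddAbove _
  · apply le_antisymm _ (le_ciInf fun i => (hbound i).1)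
    rw [← hmin]
    exact ciInf_le (Set.finite_range S.toPolygon.edgeLength).bddBelow _

end Histogram

end Watchman

namespace Watchman

/-! ### Pyramids with hidden tops -/

/-- The width of the `i`-th interval. -/
noncomputable def width (w : ℝ) (i : ℕ) : ℝ := w / 9 ^ i

/-- The left end of the `i`-th interval. The bit `b i` decides whether the next interval lies near
the right or near the left end of the `i`-th one. -/
noncomputable def leftEnd (w : ℝ) (b : ℕ → Bool) : ℕ → ℝ
  | 0 => 0
  | i + 1 => leftEnd w b i +
      if b i then width w i - 2 * width w (i + 1) else width w (i + 1)

/-- The right end of the `i`-th interval. -/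
noncomputable def rightEnd (w : ℝ) (b : ℕ → Bool) (i : ℕ) : ℝ := leftEnd w b i + width w i

theorem width_pos {w : ℝ} (hw : 0 < w) (i : ℕ) : 0 < width w i := by
  unfold width; positivity

theorem width_eq (w : ℝ) (i : ℕ) : width w i = 9 * width w (i + 1) := by
  unfold width
  field_simp
  ring

theorem width_zero (w : ℝ) : width w 0 = w := by simp [width]

theorem width_anti {w : ℝ} (hw : 0 < w) {i j : ℕ} (h : i ≤ j) : width w j ≤ width w i :=
  antitone_nat_of_succ_le (fun n => by linarith [width_eq w n, width_pos hw (n + 1)]) h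

theorem leftEnd_succ_ge {w : ℝ} (hw : 0 < w) (b : ℕ → Bool) (i : ℕ) :
    leftEnd w b i + width w (i + 1) ≤ leftEnd w b (i + 1) := by
  have h1 := width_eq w i
  have h2 := width_pos hw (i + 1)
  rw [leftEnd]
  split_ifs <;> linarith

theorem rightEnd_succ_le {w : ℝ} (hw : 0 < w) (b : ℕ → Bool) (i : ℕ) :
    rightEnd w b (i + 1) + width w (i + 1) ≤ rightEnd w b i := by
  have h1 := width_eq w i
  have h2 := width_pos hw (i + 1)
  rw [rightEnd, rightEnd, leftEnd]
  split_ifs <;> linarith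

theorem leftEnd_strictMono {w : ℝ} (hw : 0 < w) (b : ℕ → Bool) : StrictMono (leftEnd w b) :=
  strictMono_nat_of_lt_succ fun i => by
    linarith [leftEnd_succ_ge hw b i, width_pos hw (i + 1)]

theorem rightEnd_strictAnti {w : ℝ} (hw : 0 < w) (b : ℕ → Bool) : StrictAnti (rightEnd w b) :=
  strictAnti_nat_of_succ_lt fun i => by
    linarith [rightEnd_succ_le hw b i, width_pos hw (i + 1)]

theorem leftEnd_lt_rightEnd {w : ℝ} (hw : 0 < w) (b : ℕ → Bool) (i j : ℕ) :
    leftEnd w b i < rightEnd w b j := by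
  have h1 := (leftEnd_strictMono hw b).monotone (le_max_left i j)
  have h2 := (rightEnd_strictAnti hw b).antitone (le_max_right i j)
  have h3 := width_pos hw (max i j)
  rw [rightEnd] at h2
  linarith

theorem leftEnd_congr {w : ℝ} {b b' : ℕ → Bool} {i : ℕ} (h : ∀ l < i, b l = b' l) :
    leftEnd w b i = leftEnd w b' i := by
  induction i with
  | zero => rfl
  | succ i ih =>
    rw [leftEnd, leftEnd, ih fun l hl => h l (hl.trans (Nat.lt_succ_self i)),
      h i (Nat.lt_succ_self i)]

theorem rightEnd_congr {w : ℝ} {b b' : ℕ → Bool} {i : ℕ} (h : ∀ l < i, b l = b' l) :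
    rightEnd w b i = rightEnd w b' i := by
  rw [rightEnd, rightEnd, leftEnd_congr h]

/-- The next interval can be placed far from any given abscissa. -/
theorem exists_bit_far {w : ℝ} (hw : 0 < w) (b : ℕ → Bool) (m : ℕ) (x : ℝ) :
    ∃ β : Bool, ∀ b' : ℕ → Bool, (∀ l < m, b l = b' l) → b' m = β →
      x < leftEnd w b' (m + 1) - width w (m + 1) ∨
        rightEnd w b' (m + 1) + width w (m + 1) < x := by
  have h1 := width_eq w m
  have h2 := width_pos hw (m + 1)
  -- In units of `width w (m + 1)`, the current interval is `[0, 9]` and the next one is `[7, 8]` or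
  -- `[1, 2]`. Enlarged by one unit on each side, these become `[6, 9]` and `[0, 3]`, on different
  -- sides of the midpoint 4.5.
  rcases le_or_gt x (leftEnd w b m + width w m / 2) with hx | hx
  · refine ⟨true, fun b' hb hβ => Or.inl ?_⟩
    rw [leftEnd, ← leftEnd_congr hb, hβ, if_pos rfl]
    linarith
  · refine ⟨false, fun b' hb hβ => Or.inr ?_⟩
    rw [rightEnd, leftEnd, ← leftEnd_congr hb, hβ, if_neg (by simp)]
    linarith

/-- The index of the rectangle, counted from the lowest one, whose top is the top of the `j`-th
bar. -/
def barLevel (K j : ℕ) : ℕ := if 2 * j + 1 < K then 2 * j + 1 else 2 * (K - 1 - j)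

theorem barLevel_lt {K j : ℕ} (hj : j < K) : barLevel K j < K := by
  unfold barLevel; split_ifs <;> omega

/-- Levels are odd on the left slope and even on the right one, because the rectangles shrink
alternately at their right and left ends. -/
theorem barLevel_ne {K j : ℕ} (hj : j + 1 < K) : barLevel K j ≠ barLevel K (j + 1) := by
  unfold barLevel; split_ifs <;> omega

/-- The grid lines of the pyramid, from left to right. -/
noncomputable def gridLine (K : ℕ) (w : ℝ) (b : ℕ → Bool) (j : ℕ) : ℝ :=
  if 2 * j < K then leftEnd w b j else rightEnd w b (K - j)

/-- The heights of the bars of the pyramid in units, with `0` on both sides. -/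
def heightUnits (K : ℕ) : ℕ → ℕ
  | 0 => 0
  | j + 1 => if j < K then 3 ^ barLevel K j else 0

theorem heightUnits_le {K : ℕ} (j : ℕ) : heightUnits K j ≤ 3 ^ (K - 1) := by
  rcases j with _ | j
  · exact Nat.zero_le _
  · rw [heightUnits]
    split_ifs with h
    · exact Nat.pow_le_pow_right (by norm_num) (by have := barLevel_lt h; omega)
    · exact Nat.zero_le _

theorem heightUnits_ne {K : ℕ} (hK : 0 < K) {j : ℕ} (hj : j ≤ K) :
    heightUnits K j ≠ heightUnits K (j + 1) := by
  rcases j with _ | j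
  · rw [heightUnits, heightUnits, if_pos hK]
    positivity
  · rw [heightUnits, heightUnits, if_pos (show j < K from hj)]
    split_ifs with h
    · exact fun h' => barLevel_ne h (Nat.pow_right_injective (le_refl _) (by simpa using h'))
    · positivity

theorem gridLine_lt {K : ℕ} {w : ℝ} (hw : 0 < w) (b : ℕ → Bool) {i j : ℕ} (hij : i < j)
    (hj : j ≤ K) : gridLine K w b i < gridLine K w b j := by
  unfold gridLine
  split_ifs with h1 h2
  · exact leftEnd_strictMono hw b hij
  · exact leftEnd_lt_rightEnd hw b _ _
  · omega
  · exact rightEnd_strictAnti hw b (by omega)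

/-- The pyramid as a histogram. -/
noncomputable def pyramid (K : ℕ) (hK : 0 < K) (w : ℝ) (hw : 0 < w) (u : ℝ) (hu : 0 < u)
    (b : ℕ → Bool) : Histogram where
  K := K
  K_pos := hK
  X := gridLine K w b
  Y j := u * heightUnits K j
  X_lt _ _ := gridLine_lt hw b
  Y_zero := by simp [heightUnits]
  Y_last := by simp [heightUnits]
  Y_pos j hj := by
    rw [heightUnits, if_pos hj]; positivity
  Y_ne j hj h := heightUnits_ne hK hj (by exact_mod_cast mul_left_cancel₀ hu.ne' h)

/-! ### Shape, aspect ratio and visibility of the pyramids. -/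

section

variable {K : ℕ} (hK : 0 < K) {w : ℝ} (hw : 0 < w) {u : ℝ} (hu : 0 < u) (b : ℕ → Bool)

/-- The pyramid is the union of the rectangles of height `u * 3 ^ t` over the nested intervals. -/
theorem mem_pyramid_region {q : Plane} :
    q ∈ (pyramid K hK w hw u hu b).region ↔
      0 ≤ q.2 ∧ ∃ t < K, (leftEnd w b (t / 2) ≤ q.1 ∧ q.1 ≤ rightEnd w b ((t + 1) / 2)) ∧
        q.2 ≤ u * 3 ^ t := by
  constructor
  · rintro ⟨j, hj, hx, hy0, hy⟩
    change j < K at hj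
    change gridLine K w b j ≤ q.1 ∧ q.1 ≤ gridLine K w b (j + 1) at hx
    change q.2 ≤ u * heightUnits K (j + 1) at hy
    rw [heightUnits, if_pos hj] at hy
    push_cast at hy
    refine ⟨hy0, barLevel K j, barLevel_lt hj, ?_, hy⟩
    have hl := (leftEnd_strictMono hw b).monotone
    have hr := (rightEnd_strictAnti hw b).antitone
    have hlr := leftEnd_lt_rightEnd hw b
    unfold gridLine at hx
    unfold barLevel
    constructor
    · refine le_trans ?_ hx.1
      split_ifs
      · exact hl (by omega)
      · exact (hlr _ _).le
      · exact hl (by omega)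
      · exact (hlr _ _).le
    · refine hx.2.trans ?_
      split_ifs
      · exact (hlr _ _).le
      · exact (hlr _ _).le
      · exact hr (by omega)
      · exact hr (by omega)
  · rintro ⟨hy0, t, ht, hx, hy⟩
    have h1 : gridLine K w b (t / 2) = leftEnd w b (t / 2) := by
      rw [gridLine, if_pos (by omega)]
    have h2 : gridLine K w b (K - (t + 1) / 2) = rightEnd w b ((t + 1) / 2) := by
      rw [gridLine, if_neg (by omega)]
      congr 1; omega
    rw [← h1, ← h2] at hx
    obtain ⟨j, hj1, hj2, hx'⟩ := (pyramid K hK w hw u hu b).exists_between_X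
      (show t / 2 < K - (t + 1) / 2 by omega) hx.1 hx.2
    have hjK : j < K := by omega
    refine ⟨j, hjK, hx', hy0, hy.trans ?_⟩
    change _ ≤ u * (heightUnits K (j + 1) : ℝ)
    rw [heightUnits, if_pos hjK]
    push_cast
    -- Any bar over the `t`-th rectangle is at least as high as it.
    have : t ≤ barLevel K j := by unfold barLevel; split_ifs <;> omega
    gcongr
    norm_num

/-- On a horizontal line, the lower of the rectangles containing the two points contains both, since
the bases are nested. Vertically, each rectangle reaches down to the base. -/
theorem pyramid_orthoconvex : (pyramid K hK w hw u hu b).toPolygon.Orthoconvex := by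
  constructor
  · refine fun y => ⟨?_⟩
    rintro x₁ h₁ x₂ h₂ x ⟨hx1, hx2⟩
    obtain ⟨h0, t, ht, hxt, hyt⟩ := (mem_pyramid_region hK hw hu b).1 h₁
    obtain ⟨-, s, hs, hxs, hys⟩ := (mem_pyramid_region hK hw hu b).1 h₂
    refine (mem_pyramid_region hK hw hu b).2
      ⟨h0, min t s, (min_le_left _ _).trans_lt ht, ⟨?_, ?_⟩, ?_⟩
    · exact ((leftEnd_strictMono hw b).monotone
        (Nat.div_le_div_right (min_le_left _ _))).trans (hxt.1.trans hx1)
    · refine (hx2.trans hxs.2).trans ((rightEnd_strictAnti hw b).antitone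
        (Nat.div_le_div_right (Nat.add_le_add_right (min_le_right _ _) 1)))
    · rcases min_choice t s with h | h <;> rw [h] <;> assumption
  · refine fun x => ⟨?_⟩
    rintro y₁ h₁ y₂ h₂ y ⟨hy1, hy2⟩
    obtain ⟨h0, -⟩ := (mem_pyramid_region hK hw hu b).1 h₁
    obtain ⟨-, s, hs, hxs, hys⟩ := (mem_pyramid_region hK hw hu b).1 h₂
    exact (mem_pyramid_region hK hw hu b).2 ⟨h0.trans hy1, s, hs, hxs, hy2.trans hys⟩

/-- Widths shrink and heights grow by the same factor 9 per interval. Thus the one condition `u * 9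
^ p ≤ w` both keeps every bar at least `u` wide and keeps the height at most `w`. -/
theorem pyramid_aspectRatio {p : ℕ} (hKp : K = 2 * p + 1) (hup : u * 9 ^ p ≤ w) :
    (pyramid K hK w hw u hu b).toPolygon.aspectRatio = w / u := by
  have hwidth : (pyramid K hK w hw u hu b).X K - (pyramid K hK w hw u hu b).X 0 = w := by
    change gridLine K w b K - gridLine K w b 0 = w
    rw [gridLine, gridLine, if_neg (by omega), if_pos (by omega), Nat.sub_self, rightEnd,
      leftEnd, width_zero]
    ring
  have hmin : u ≤ width w p := by
    rw [width, le_div_iff₀ (by positivity)]; exact hup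
  have h := (pyramid K hK w hw u hu b).aspectRatio_toPolygon (u := u) ?_ ?_ ?_
  · rw [h]; exact congrArg (· / u) hwidth
  · intro j hj
    change j < K at hj
    change u ≤ gridLine K w b (j + 1) - gridLine K w b j
    unfold gridLine
    split_ifs with h1 h2
    · have e1 := leftEnd_succ_ge hw b j
      have e2 := width_anti hw (show j + 1 ≤ p by omega)
      linarith
    · omega
    · obtain rfl : j = p := by omega
      rw [show K - (j + 1) = j by omega, rightEnd]
      linarith
    · have e1 := rightEnd_succ_le hw b (K - (j + 1))
      have e2 := width_anti hw (show K - (j + 1) + 1 ≤ p by omega)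
      rw [show K - j = K - (j + 1) + 1 by omega]
      linarith
  · intro j hj
    change u ≤ |u * (heightUnits K j : ℝ) - u * (heightUnits K (j + 1) : ℝ)| ∧
      |u * (heightUnits K j : ℝ) - u * (heightUnits K (j + 1) : ℝ)| ≤
        (pyramid K hK w hw u hu b).X K - (pyramid K hK w hw u hu b).X 0
    rw [hwidth, ← mul_sub, abs_mul, abs_of_pos hu]
    constructor
    · have : (1 : ℤ) ≤ |(heightUnits K j : ℤ) - (heightUnits K (j + 1) : ℤ)| :=
        Int.one_le_abs (sub_ne_zero.2 (by exact_mod_cast heightUnits_ne hK hj))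
      have : (1 : ℝ) ≤ |(heightUnits K j : ℝ) - (heightUnits K (j + 1) : ℝ)| := by
        exact_mod_cast this
      nlinarith
    · have e : ∀ i, (heightUnits K i : ℝ) ≤ 9 ^ p := by
        intro i
        have := heightUnits_le (K := K) i
        rw [show K - 1 = 2 * p by omega, pow_mul] at this
        exact_mod_cast this
      refine le_trans (mul_le_mul_of_nonneg_left ?_ hu.le) hup
      rw [abs_le]
      constructor <;>
        linarith [e j, e (j + 1), Nat.cast_nonneg (α := ℝ) (heightUnits K j),
          Nat.cast_nonneg (α := ℝ) (heightUnits K (j + 1))]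
  · change u * (heightUnits K K : ℝ) = u
    obtain ⟨l, rfl⟩ : ∃ l, K = l + 1 := ⟨2 * p, hKp⟩
    rw [heightUnits, if_pos (Nat.lt_succ_self l), barLevel, if_neg (by omega)]
    simp

/-- Pyramids whose first `m` bits agree coincide up to the height of the `m`-th interval. -/
theorem mem_pyramid_congr {b b' : ℕ → Bool} {m : ℕ} (hb : ∀ l < m, b l = b' l) {q : Plane}
    (hq : q.2 < u * 3 ^ (2 * m)) (h : q ∈ (pyramid K hK w hw u hu b).region) :
    q ∈ (pyramid K hK w hw u hu b').region := by
  obtain ⟨h0, t, ht, hx, hy⟩ := (mem_pyramid_region hK hw hu b).1 h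
  refine (mem_pyramid_region hK hw hu b').2 ⟨h0, ?_⟩
  have key : ∀ s ≤ 2 * m, leftEnd w b (s / 2) = leftEnd w b' (s / 2) ∧
      rightEnd w b ((s + 1) / 2) = rightEnd w b' ((s + 1) / 2) := fun s hs =>
    ⟨leftEnd_congr fun l hl => hb l (by omega), rightEnd_congr fun l hl => hb l (by omega)⟩
  rcases le_total t (2 * m) with htm | htm
  · rw [(key t htm).1, (key t htm).2] at hx
    exact ⟨t, ht, hx, hy⟩
  -- Higher rectangles may differ, but below this height they lie within rectangle `2 * m`, which is
  -- common to both pyramids.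
  · refine ⟨2 * m, by omega, ?_, hq.le⟩
    rw [← (key _ le_rfl).1, ← (key _ le_rfl).2]
    exact ⟨((leftEnd_strictMono hw b).monotone (by omega)).trans hx.1,
      hx.2.trans ((rightEnd_strictAnti hw b).antitone (by omega))⟩

/-- From a point that is far from the `m`-th interval one cannot see the top of the rectangle over
this interval. -/
theorem snd_lt_of_visible {m : ℕ} {p q : Plane}
    (hp : p.1 < leftEnd w b (m + 1) - width w (m + 1) ∨
      rightEnd w b (m + 1) + width w (m + 1) < p.1)
    (hq : q ∈ (pyramid K hK w hw u hu b).toPolygon.visible p) :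
    q.2 < u * 3 ^ (2 * (m + 1)) := by
  by_contra hcon
  have hw' := width_pos hw (m + 1)
  have hpos : 0 < u * 3 ^ (2 * m + 1) := by positivity
  have hpow : u * 3 ^ (2 * (m + 1)) = 3 * (u * 3 ^ (2 * m + 1)) := by ring
  rw [hpow, not_lt] at hcon
  have hin : ∀ z ∈ (pyramid K hK w hw u hu b).region, u * 3 ^ (2 * m + 1) < z.2 →
      leftEnd w b (m + 1) ≤ z.1 ∧ z.1 ≤ rightEnd w b (m + 1) := by
    intro z hz hz2
    obtain ⟨h0, t, ht, hx, hy⟩ := (mem_pyramid_region hK hw hu b).1 hz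
    have htm : 2 * m + 1 < t := by
      by_contra h
      have : u * 3 ^ t ≤ u * 3 ^ (2 * m + 1) := by
        gcongr
        · norm_num
        · omega
      linarith
    exact ⟨((leftEnd_strictMono hw b).monotone (by omega)).trans hx.1,
      hx.2.trans ((rightEnd_strictAnti hw b).antitone (by omega))⟩
  have hseg : segment ℝ p q ⊆ (pyramid K hK w hw u hu b).region := hq
  have hp0 := ((mem_pyramid_region hK hw hu b).1 (hseg (left_mem_segment ℝ p q))).1
  have hqi := hin q (hseg (right_mem_segment ℝ p q)) (by linarith)
  -- As heights triple, half the height of `q` still exceeds the rectangle below; hence the midpoint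
  -- lies over the interval too.
  have hmid : ((1 / 2 : ℝ) • p + (1 / 2 : ℝ) • q) ∈ segment ℝ p q :=
    ⟨1 / 2, 1 / 2, by norm_num, by norm_num, by norm_num, rfl⟩
  have hmi := hin _ (hseg hmid) (by
    simp only [Prod.snd_add, Prod.smul_snd, smul_eq_mul]; linarith)
  simp only [Prod.fst_add, Prod.smul_fst, smul_eq_mul] at hmi
  rw [rightEnd] at *
  rcases hp with h | h <;> linarith [hmi.1, hmi.2, hqi.1, hqi.2]

/-- Some point of the base sees the whole pyramid. -/
theorem visible_base : (pyramid K hK w hw u hu b).toPolygon.visible (leftEnd w b (K / 2), 0) =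
    (pyramid K hK w hw u hu b).region := by
  apply Set.Subset.antisymm
  · exact fun q hq => hq (right_mem_segment ℝ _ _)
  · intro q hq z hz
    obtain ⟨h0, t, ht, hx, hy⟩ := (mem_pyramid_region hK hw hu b).1 hq
    have hconv : Convex ℝ (Set.Icc (leftEnd w b (t / 2)) (rightEnd w b ((t + 1) / 2)) ×ˢ
      Set.Icc 0 (u * 3 ^ t)) := (convex_Icc _ _).prod (convex_Icc _ _)
    have hz' := hconv.segment_subset (x := (leftEnd w b (K / 2), 0)) (y := q)
      ⟨⟨(leftEnd_strictMono hw b).monotone (by omega : t / 2 ≤ K / 2),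
        (leftEnd_lt_rightEnd hw b _ _).le⟩, le_rfl, by positivity⟩ ⟨hx, h0, hy⟩ hz
    exact (mem_pyramid_region hK hw hu b).2 ⟨hz'.2.1, t, ht, hz'.1, hz'.2.2⟩

theorem mem_pyramid_region_of_base {x : ℝ} (h0 : 0 ≤ x) (hx : x ≤ w) :
    ((x, 0) : Plane) ∈ (pyramid K hK w hw u hu b).region := by
  refine (mem_pyramid_region hK hw hu b).2 ⟨le_rfl, 0, hK, ⟨h0, ?_⟩, by positivity⟩
  rw [Nat.zero_add, show 1 / 2 = 0 from rfl, rightEnd, leftEnd, width_zero]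
  linarith

end

end Watchman

namespace Watchman

/-! ### The offline tour -/

/-- The straight move along the `x`-axis from `x` to `y`. -/
noncomputable def baseMove (x y : ℝ) : Curve where
  toFun t := (x + t * (y - x), 0)
  continuous_toFun := by fun_prop

/-- The move is Lipschitz with constant `|y - x|` in the time parameter, whose variation is at most
1. -/
theorem length_baseMove_le (x y : ℝ) : Curve.length (baseMove x y) ≤ ENNReal.ofReal |y - x| := by
  have hlip : LipschitzWith (Real.toNNReal |y - x|)
      (fun t : ℝ => WithLp.toLp 1 ((x + t * (y - x), 0) : Plane)) := by
    refine LipschitzWith.of_dist_le_mul fun s t => ?_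
    rw [WithLp.prod_dist_eq_of_L1, Real.coe_toNNReal _ (abs_nonneg _)]
    change dist (x + s * (y - x)) (x + t * (y - x)) + dist (0 : ℝ) 0 ≤ _
    rw [dist_self, add_zero, Real.dist_eq, Real.dist_eq, ← abs_mul]
    exact le_of_eq (congrArg abs (by ring))
  have hmono : eVariationOn (Subtype.val : unitInterval → ℝ) Set.univ ≤ 1 := by
    have h := (Subtype.mono_coe (· ∈ unitInterval)).monotoneOn Set.univ |>.eVariationOn_eq
      (Set.mem_univ (0 : unitInterval)) (Set.mem_univ (1 : unitInterval))
    have hI : (Set.univ ∩ Set.Icc (0 : unitInterval) 1) = Set.univ := by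
      rw [Set.univ_inter]
      exact Set.eq_univ_of_forall fun t => ⟨unitInterval.nonneg', unitInterval.le_one'⟩
    rw [hI] at h
    simpa using h.le
  calc Curve.length (baseMove x y)
      ≤ (Real.toNNReal |y - x|) * eVariationOn (Subtype.val : unitInterval → ℝ) Set.univ :=
        (hlip.lipschitzOnWith (s := Set.univ)).comp_eVariationOn_le (Set.mapsTo_univ _ _)
    _ ≤ (Real.toNNReal |y - x|) * 1 := by gcongr
    _ = ENNReal.ofReal |y - x| := mul_one _

section

variable {K : ℕ} (hK : 0 < K) {w : ℝ} (hw : 0 < w) {u : ℝ} (hu : 0 < u) (b : ℕ → Bool)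

/-- One scan suffices for a pyramid if one knows where its top is. -/
theorem opt_pyramid_le (r : Rule) {c : ℝ≥0} (hc : 2 * w ≤ c) :
    opt r c (pyramid K hK w hw u hu b).toPolygon (0, 0) ≤ 2 * c := by
  set x := leftEnd w b (K / 2) with hx
  have hx0 : 0 ≤ x := (leftEnd_strictMono hw b).monotone (Nat.zero_le _)
  have hxw : x ≤ w := by
    have := (leftEnd_lt_rightEnd hw b (K / 2) 0).le
    rwa [rightEnd, leftEnd, width_zero, zero_add] at this
  have hT : Tour.Explores ⟨[baseMove 0 x], baseMove x 0⟩ r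
      (pyramid K hK w hw u hu b).toPolygon (0, 0) := by
    have hscan : (baseMove 0 x) 1 = (x, 0) := by simp [baseMove]
    have hvis := visible_base hK hw hu b
    rw [← hx] at hvis
    refine ⟨?_, ?_, ?_, ?_⟩
    · simp [Joins, baseMove]
    · intro γ hγ t
      have ht0 := t.2.1
      have ht1 := t.2.2
      simp only [List.cons_append, List.nil_append, List.mem_cons, List.not_mem_nil,
        or_false] at hγ
      rcases hγ with rfl | rfl
      · exact mem_pyramid_region_of_base hK hw hu b (by nlinarith) (by nlinarith)
      · exact mem_pyramid_region_of_base hK hw hu b (by nlinarith) (by nlinarith)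
    · intro q hq
      refine ⟨(x, 0), by simp [Tour.scanPoints, hscan], ?_⟩
      rw [hvis]; exact hq
    · intro _ i
      refine ⟨(x, 0), by simp [Tour.scanPoints, hscan], ?_⟩
      rw [hvis]
      intro q hq
      have hf := Set.mem_iUnion_of_mem i hq
      exact ((pyramid K hK w hw u hu b).iUnion_edges_subset hf).1
  refine (iInf₂_le (f := fun (T : Tour) (_ : T.Explores r _ _) => T.cost c) _ hT).trans ?_
  have hlen : ∀ a d : ℝ, |d - a| ≤ w → Curve.length (baseMove a d) ≤ ENNReal.ofReal w :=
    fun a d h => (length_baseMove_le a d).trans (ENNReal.ofReal_le_ofReal h)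
  have h1 := hlen 0 x (by rw [sub_zero, abs_of_nonneg hx0]; exact hxw)
  have h2 := hlen x 0 (by rw [zero_sub, abs_neg, abs_of_nonneg hx0]; exact hxw)
  have hww : ENNReal.ofReal w + ENNReal.ofReal w ≤ c := by
    rw [← ENNReal.ofReal_add hw.le hw.le, ← ENNReal.ofReal_coe_nnreal]
    exact ENNReal.ofReal_le_ofReal (by linarith)
  simp only [Tour.cost, List.length_singleton, Nat.cast_one, mul_one, List.map_cons, List.map_nil,
    List.sum_cons, List.sum_nil, add_zero]
  rw [two_mul]
  gcongr
  exact (add_le_add h1 h2).trans hww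

/-! ### The adversary -/

/-- Every point of a sight line is itself visible, hence low, so the whole sight line lies in the
common part of the two pyramids. -/
theorem visible_subset_of_agree {b b' : ℕ → Bool} {m : ℕ} (hb : ∀ l < m, b l = b' l) {p : Plane}
    (h : ∀ q ∈ (pyramid K hK w hw u hu b).toPolygon.visible p, q.2 < u * 3 ^ (2 * m)) :
    (pyramid K hK w hw u hu b).toPolygon.visible p ⊆
      (pyramid K hK w hw u hu b').toPolygon.visible p := by
  intro q hq z hz
  have hzv : z ∈ (pyramid K hK w hw u hu b).toPolygon.visible p :=
    ((convex_segment p q).segment_subset (left_mem_segment ℝ p q) hz).trans hq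
  exact mem_pyramid_congr hK hw hu hb (h z hzv) (hq hz)

/-- Being interior is a local property, and the strict height bound cuts out an open set on which
the two pyramids coincide. -/
theorem frontier_subset_of_agree {b b' : ℕ → Bool} {m : ℕ} (hb : ∀ l < m, b l = b' l) {q : Plane}
    (hq : q.2 < u * 3 ^ (2 * m)) (h : q ∈ frontier (pyramid K hK w hw u hu b).region) :
    q ∈ frontier (pyramid K hK w hw u hu b').region := by
  rw [(Histogram.isCompact_region _).isClosed.frontier_eq] at h ⊢
  refine ⟨mem_pyramid_congr hK hw hu hb hq h.1, fun hi => h.2 ?_⟩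
  rw [mem_interior_iff_mem_nhds] at hi ⊢
  have hnear : {z : Plane | z.2 < u * 3 ^ (2 * m)} ∈ nhds q :=
    (isOpen_lt continuous_snd continuous_const).mem_nhds hq
  filter_upwards [hi, hnear] with z hz hz'
  exact mem_pyramid_congr hK hw hu (fun l hl => (hb l hl).symm) hz' hz

/-- Scans that do not see beyond the `m`-th interval do not distinguish pyramids whose first `m`
bits agree. -/
theorem scan_eq_of_agree {b b' : ℕ → Bool} {m : ℕ} (hb : ∀ l < m, b l = b' l) {p : Plane}
    (h : ∀ q ∈ (pyramid K hK w hw u hu b).toPolygon.visible p, q.2 < u * 3 ^ (2 * m))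
    (h' : ∀ q ∈ (pyramid K hK w hw u hu b').toPolygon.visible p, q.2 < u * 3 ^ (2 * m)) :
    scan (pyramid K hK w hw u hu b).toPolygon p =
      scan (pyramid K hK w hw u hu b').toPolygon p := by
  have hb' : ∀ l < m, b' l = b l := fun l hl => (hb l hl).symm
  have hv := Set.Subset.antisymm (visible_subset_of_agree hK hw hu hb h)
    (visible_subset_of_agree hK hw hu hb' h')
  have hf : (pyramid K hK w hw u hu b).toPolygon.visible p ∩
        frontier (pyramid K hK w hw u hu b).toPolygon.region =
      (pyramid K hK w hw u hu b').toPolygon.visible p ∩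
        frontier (pyramid K hK w hw u hu b').toPolygon.region := by
    apply Set.Subset.antisymm
    · exact fun q hq => ⟨hv ▸ hq.1, frontier_subset_of_agree hK hw hu hb (h q hq.1) hq.2⟩
    · exact fun q hq => ⟨hv ▸ hq.1, frontier_subset_of_agree hK hw hu hb' (h' q hq.1) hq.2⟩
  unfold scan
  rw [hv] at hf ⊢
  rw [hf]

/-- For every strategy, the bits can be fixed one by one so that each scan reveals only one more
interval. -/
theorem exists_bits_of_strategy {σ : Strategy} {r : Rule} {T : (ℕ → Bool) → Tour} {s : Plane}
    (hprod : ∀ b, σ.Produces (pyramid K hK w hw u hu b).toPolygon s (T b))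
    (hexpl : ∀ b, (T b).Explores r (pyramid K hK w hw u hu b).toPolygon s)
    (j : ℕ) (hj : 2 * j < K + 2) :
    ∃ (b : ℕ → Bool) (ps : List Plane), ps.length = j ∧ ∀ b', (∀ l < j, b l = b' l) →
      j ≤ (T b').legs.length ∧ (T b').scanPoints.take j = ps ∧
      ∀ p ∈ ps, ∀ q ∈ (pyramid K hK w hw u hu b').toPolygon.visible p,
        q.2 < u * 3 ^ (2 * j) := by
  induction j with
  | zero => exact ⟨fun _ => true, [], rfl, fun b' _ => ⟨Nat.zero_le _, by simp, by simp⟩⟩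
  | succ j ih =>
    obtain ⟨b, ps, hlen, hps⟩ := ih (by omega)
    -- No tour compatible with the fixed bits can stop yet: the top has height `u * 3 ^ (K - 1)`,
    -- and `2 * j ≤ K - 1`, so no scan so far has seen it.
    have hunf : ∀ b', (∀ l < j, b l = b' l) → j < (T b').legs.length := by
      intro b' hb'
      obtain ⟨h1, h2, h3⟩ := hps b' hb'
      refine lt_of_le_of_ne h1 fun heq => ?_
      have hall : (T b').scanPoints = ps := by
        rw [← h2, List.take_of_length_le]
        simp [Tour.scanPoints, heq]
      have htop : ((leftEnd w b' (K / 2), u * 3 ^ (K - 1)) : Plane) ∈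
          (pyramid K hK w hw u hu b').region :=
        (mem_pyramid_region hK hw hu b').2 ⟨by positivity, K - 1, by omega,
          ⟨(leftEnd_strictMono hw b').monotone (by omega : (K - 1) / 2 ≤ K / 2),
            (leftEnd_lt_rightEnd hw b' _ _).le⟩, le_rfl⟩
      obtain ⟨p, hp, hvis⟩ := (hexpl b').sees _ htop
      rw [hall] at hp
      have h4 := h3 p hp _ hvis
      have : u * 3 ^ (2 * j) ≤ u * 3 ^ (K - 1) := by
        gcongr
        · norm_num
        · omega
      dsimp only at h4
      linarith
    have hobs : ∀ b', (∀ l < j, b l = b' l) →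
        σ s (ps.map (scan (pyramid K hK w hw u hu b).toPolygon)) =
          σ s (((T b').scanPoints.take j).map (scan (pyramid K hK w hw u hu b').toPolygon)) := by
      intro b' hb'
      rw [(hps b' hb').2.1]
      congr 1
      refine List.map_congr_left fun p hp => ?_
      exact scan_eq_of_agree hK hw hu hb' ((hps b fun _ _ => rfl).2.2 p hp)
        ((hps b' hb').2.2 p hp)
    -- The next leg is the same for all continuations of the bits, so bit `j` may be chosen in view
    -- of its end point.
    obtain ⟨γ, hγ⟩ : ∃ γ, σ s (ps.map (scan (pyramid K hK w hw u hu b).toPolygon)) =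
        Action.moveAndScan γ :=
      ⟨_, (hobs b fun _ _ => rfl).trans ((hprod b).1 j (hunf b fun _ _ => rfl))⟩
    obtain ⟨β, hβ⟩ := exists_bit_far hw b j (γ 1).1
    refine ⟨Function.update b j β, ps ++ [γ 1], by simp [hlen], fun b' hb' => ?_⟩
    have hagree : ∀ l < j, b l = b' l := fun l hl => by
      rw [← hb' l (by omega), Function.update_of_ne (by omega)]
    have hbit : b' j = β := by
      rw [← hb' j (Nat.lt_succ_self j), Function.update_self]
    obtain ⟨-, h2, h3⟩ := hps b' hagree
    have hleg : (T b').legs[j]'(hunf b' hagree) = γ := by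
      have := (hobs b' hagree).symm.trans hγ
      rw [(hprod b').1 j (hunf b' hagree)] at this
      exact Action.moveAndScan.inj this
    refine ⟨hunf b' hagree, ?_, ?_⟩
    · have hl : j < (T b').scanPoints.length := by
        simpa [Tour.scanPoints] using hunf b' hagree
      rw [List.take_succ_eq_append_getElem hl, h2]
      simp [Tour.scanPoints, hleg]
    · intro p hp q hq
      rcases List.mem_append.1 hp with hp | hp
      · refine (h3 p hp q hq).trans_le ?_
        gcongr
        · norm_num
        · omega
      · rw [List.mem_singleton] at hp
        subst hp
        exact snd_lt_of_visible hK hw hu b' (hβ b' hagree hbit) hq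

/-- The competitive ratio on any class that contains all pyramids is at least a quarter of the
number of bars. -/
theorem competitive_ratio_ge {r : Rule} {c : ℝ≥0} (hc : 2 * w ≤ c) {σ : Strategy} {ρ : ℝ≥0}
    {Cl : Set RectilinearPolygon}
    (hCl : ∀ b, (pyramid K hK w hw u hu b).toPolygon ∈ Cl) (hσ : σ.IsCompetitive r c Cl ρ) :
    (K : ℝ) ≤ 4 * ρ := by
  have hcpos : 0 < c := by
    rw [← NNReal.coe_pos]; linarith
  choose T hprod hexpl hcost using fun b => hσ _ (hCl b) (0, 0)
    (mem_pyramid_region_of_base hK hw hu b le_rfl hw.le)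
  obtain ⟨b, _, _, hb⟩ := exists_bits_of_strategy hK hw hu hprod hexpl ((K + 1) / 2) (by omega)
  have hscans : K ≤ 2 * (T b).legs.length := by
    have := (hb b fun _ _ => rfl).1
    omega
  -- Only the scan costs of the online tour are counted.
  have h : (c : ℝ≥0∞) * (T b).legs.length ≤ ρ * (2 * c) :=
    calc (c : ℝ≥0∞) * (T b).legs.length ≤ (T b).cost c := le_self_add
      _ ≤ ρ * opt r c (pyramid K hK w hw u hu b).toPolygon (0, 0) := hcost b
      _ ≤ ρ * (2 * c) := by gcongr; exact opt_pyramid_le hK hw hu b r hc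
  have h' : (c : ℝ) * (T b).legs.length ≤ ρ * (2 * c) := by exact_mod_cast h
  have hcpos' : (0 : ℝ) < c := hcpos
  have h'' : ((T b).legs.length : ℝ) ≤ 2 * ρ := by
    refine le_of_mul_le_mul_left ?_ hcpos'
    linarith
  have hK' : (K : ℝ) ≤ 2 * (T b).legs.length := by exact_mod_cast hscans
  linarith

end

end Watchman

/-! ### Choice of the parameters for the two bounds. -/

theorem mainTheorem1 :
    ∃ κ : ℝ, 0 < κ ∧
      ∀ (r : Watchman.Rule) (c : ℝ≥0), 0 < c →
        ∀ (σ : Watchman.Strategy) (ρ : ℝ≥0),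
          (∀ A : ℝ, 1 ≤ A →
            σ.IsCompetitive r c {P | P.Orthoconvex ∧ P.aspectRatio = A} ρ →
              κ * Real.log A ≤ ρ) ∧
          (∀ n : ℕ, 4 ≤ n → Even n →
            σ.IsCompetitive r c {P | P.Orthoconvex ∧ P.n = n} ρ →
              κ * n ≤ ρ) := by
  refine ⟨1 / 32, by norm_num, fun r c hc σ ρ => ⟨fun A hA hσ => ?_, fun n hn hn2 hσ => ?_⟩⟩
  -- With `9 ^ p ≤ A < 9 ^ (p + 1)` and `K = 2 * p + 1`, the unit height `w / A` makes the aspect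
  -- ratio exactly `A`. Then `log A ≤ 8 * (p + 1) ≤ 8 * K ≤ 32 * ρ`.
  · obtain ⟨p, hp1, hp2⟩ := exists_nat_pow_near hA (show (1 : ℝ) < 9 by norm_num)
    have hA0 : 0 < A := by linarith
    have hw : (0 : ℝ) < c / 2 := half_pos hc
    have hu : (0 : ℝ) < c / 2 / A := div_pos hw hA0
    have hK : 0 < 2 * p + 1 := Nat.succ_pos _
    have h := Watchman.competitive_ratio_ge hK hw hu (by linarith)
      (Cl := {P | P.Orthoconvex ∧ P.aspectRatio = A})
      (fun b => ⟨Watchman.pyramid_orthoconvex hK hw hu b, by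
        rw [Watchman.pyramid_aspectRatio hK hw hu b rfl, div_div_cancel₀ hw.ne']
        rw [div_mul_eq_mul_div, div_le_iff₀ hA0]
        exact mul_le_mul_of_nonneg_left hp1 hw.le⟩) hσ
    have hlog : Real.log A ≤ (p + 1) * 8 := by
      calc Real.log A ≤ Real.log (9 ^ (p + 1)) := Real.log_le_log hA0 hp2.le
        _ = (p + 1) * Real.log 9 := by rw [Real.log_pow]; push_cast; ring
        _ ≤ (p + 1) * 8 := by
          gcongr
          exact (Real.log_le_sub_one_of_pos (by norm_num)).trans (by norm_num)
    push_cast at h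
    have : (0 : ℝ) ≤ p := Nat.cast_nonneg p
    linarith
  · obtain ⟨m, rfl⟩ := hn2
    have hw : (0 : ℝ) < c / 2 := half_pos hc
    -- `K = m - 1` bars give `2 * m` edges. The unit height is arbitrary, as the offline tour stays
    -- on the base.
    have hK : 0 < m - 1 := by omega
    have h := Watchman.competitive_ratio_ge hK hw one_pos (by linarith)
      (Cl := {P | P.Orthoconvex ∧ P.n = m + m})
      (fun b => ⟨Watchman.pyramid_orthoconvex hK hw one_pos b, by
        change 2 * (m - 1) + 2 = m + m
        omega⟩) hσ
    have hm : ((m + m : ℕ) : ℝ) ≤ 4 * (m - 1 : ℕ) := by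
      exact_mod_cast (by omega : m + m ≤ 4 * (m - 1))
    linarith
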